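/- Let $\mathbb K\in\{\mathbb R,\mathbb C\}$. For a normed space $X$ over $\mathbb K$ and a continuous symmetric bilinear form $L:X\times X\to\mathbb K$ put $\widehat L(x)=L(x,x)$, $\|L\|=\sup\{|L(x,y)|:\|x\|,\|y\|\le 1\}$ and $\|\widehat L\|=\sup\{|\widehat L(x)|:\|x\|\le 1\}$. Let $$\mathbb K(2,X)=\inf\{M>0:\ \|L\|\le M\|\widehat L\|\ \text{for every continuous symmetric bilinear form } L \text{ on } X\}$$ and, for $1\le p\le\infty$, $\mathbb K(2,p)=\sup_\mu \mathbb K(2,L_p(\mu))$, the supremum being over all measures $\mu$, with $L_p(\mu)$ the space of $\mathbb K$-valued functions; write $\mathbb R(2,p)$ for $\mathbb K(2,p)$ when $\mathbb K=\mathbb R$, and similarly $\mathbb R(2,X)$. Let $\ell_p$ be the space of $p$-summable (bounded, if $p=\infty$) sequences in $\mathbb K$. For $p=\infty$ the fraction $(p-2)/p$ is read as $1$ and $2^{-2/p}$ as $1$. 1. For $\mathbb K=\mathbb R$ or $\mathbb C$ and $1\le p\le\infty$, $\mathbb K(2,p)\le 2^{|p-2|/p}$. 2. For $\mathbb K=\mathbb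 R$ or $\mathbb C$ and $1\le p\le 2$, $$\mathbb K(2,p)=\mathbb K(2,\ell_p)=2^{(2-p)/p}.$$ Equality is attained on $\ell_p$ by the continuous symmetric bilinear form $L(x,y)=\frac12(x_1y_2+x_2y_1)$, for which $\widehat L(x)=x_1x_2$, $\|L\|=\frac12$, $\|\widehat L\|=2^{-2/p}$, and so $\|L\|=2^{(2-p)/p}\|\widehat L\|$. 3. For real scalars and $2\le p\le\infty$, $$\mathbb R(2,p)=\mathbb R(2,\ell_p)=2^{(p-2)/p}.$$ Equality is attained on the real space $\ell_p$ by the continuous symmetric bilinear form $L(x,y)=x_1y_1-x_2y_2$, for which $\widehat L(x)=x_1^2-x_2^2$, $\|\widehat L\|=1$ and $\|L\|=2^{(p-2)/p}\|\widehat L\|$. 4. In particular, $\mathbb R(2,\infty)=2$. -/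

import Mathlib

open MeasureTheory
open scoped ENNReal NNReal

universe u v

noncomputable section

/-- A multilinear form is symmetric if permuting its arguments does not change its value. -/
def IsSymmForm {𝕜 X : Type*} [RCLike 𝕜] [NormedAddCommGroup X] [NormedSpace 𝕜 X] {m : ℕ}
    (L : ContinuousMultilinearMap 𝕜 (fun _ : Fin m => X) 𝕜) : Prop :=
  ∀ (σ : Equiv.Perm (Fin m)) (x : Fin m → X), L (fun i => x (σ i)) = L x

/-- The homogeneous polynomial `x ↦ L (x, …, x)` associated with an `m`-linear form `L`. -/
def hatPoly {𝕜 X : Type*} [RCLike 𝕜] [NormedAddCommGroup X] [NormedSpace 𝕜 X] {m : ℕ}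
    (L : ContinuousMultilinearMap 𝕜 (fun _ : Fin m => X) 𝕜) (x : X) : 𝕜 :=
  L (fun _ => x)

/-- The norm `sup {|P x| : ‖x‖ ≤ 1}` of `P = hatPoly L`. The set is non-empty, and it is bounded
because `L` is continuous, so the supremum is a genuine one. -/
def hatNorm {𝕜 X : Type*} [RCLike 𝕜] [NormedAddCommGroup X] [NormedSpace 𝕜 X] {m : ℕ}
    (L : ContinuousMultilinearMap 𝕜 (fun _ : Fin m => X) 𝕜) : ℝ :=
  sSup ((fun x : X => ‖hatPoly L x‖) '' Metric.closedBall (0 : X) 1)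

/-- The `m`-th polarization constant of `X`: the infimum of the real `M > 0` such that
`‖L‖ ≤ M ‖hatPoly L‖` for every continuous symmetric `m`-linear form `L` on `X`. It takes values
in `[0, ∞]` (value `∞` if there is no such `M`); `‖L‖` is the usual norm of a continuous
multilinear form. -/
def polConst (𝕜 : Type*) [RCLike 𝕜] (m : ℕ) (X : Type*) [NormedAddCommGroup X]
    [NormedSpace 𝕜 X] : ℝ≥0∞ :=
  ⨅ (M : ℝ≥0) (_ : 0 < M ∧ ∀ L : ContinuousMultilinearMap 𝕜 (fun _ : Fin m => X) 𝕜,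
    IsSymmForm L → ‖L‖ ≤ M * hatNorm L), (M : ℝ≥0∞)

/-- `𝕂(m, p)`: the supremum over all measures `μ` of the `m`-th polarization constants of
the spaces `L_p(μ)` of `𝕜`-valued functions. -/
def polConstLp (𝕜 : Type v) [RCLike 𝕜] (m : ℕ) (p : ℝ≥0∞) [Fact (1 ≤ p)] : ℝ≥0∞ :=
  ⨆ (Ω : Type u) (_ : MeasurableSpace Ω) (μ : Measure Ω), polConst 𝕜 m (Lp 𝕜 p μ)

/-- The number `(p - 2) / p`, to be read as `1` for `p = ∞`. -/
def ratioExp (p : ℝ≥0∞) : ℝ :=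
  if p = ∞ then 1 else (p.toReal - 2) / p.toReal

end

/-! ### Bilinear polarization and polarization constants. -/

section Polarization

variable {𝕜 X Y : Type*} [RCLike 𝕜] [NormedAddCommGroup X] [NormedSpace 𝕜 X]
  [NormedAddCommGroup Y] [NormedSpace 𝕜 Y] {m : ℕ}

/-! Since `4 L(x, y) = P(x + y) - P(x - y)`, where `P` is the quadratic form of `L`, a bound `‖x +
y‖² + ‖x - y‖² ≤ 4C` on the unit ball gives `‖L‖ ≤ C ‖P‖` (`IsSymmForm.opNorm_le_mul_hatNorm`). In
`L_p` this holds with `C = 2 ^ (|p - 2| / p)`: for finite `p`, an inequality between scalars,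
deduced from the parallelogram law, is integrated (`Lp_norm_add_sq_add_norm_sub_sq_le`).

For sharpness, `ℓ_p` is identified with `L_p` of a counting measure, and an explicit form on two
coordinates attains the bound (`polConst_eq_of_extremal`): `hyperbolicForm` for `p ≤ 2`,
`differenceForm` for real scalars and `p ≥ 2`. -/

lemma norm_hatPoly_le_hatNorm (L : ContinuousMultilinearMap 𝕜 (fun _ : Fin m => X) 𝕜) {x : X}
    (hx : ‖x‖ ≤ 1) : ‖hatPoly L x‖ ≤ hatNorm L := by
  refine le_csSup ⟨‖L‖, ?_⟩ ⟨x, by simpa using hx, rfl⟩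
  rintro _ ⟨y, hy, rfl⟩
  have h := L.le_opNorm_mul_prod_of_le (m := fun _ => y) (b := fun _ => 1)
    fun _ => by simpa using hy
  simpa [hatPoly] using h

lemma hatNorm_nonneg (L : ContinuousMultilinearMap 𝕜 (fun _ : Fin m => X) 𝕜) : 0 ≤ hatNorm L :=
  (norm_nonneg _).trans (norm_hatPoly_le_hatNorm L (x := 0) (by simp))

lemma hatNorm_le {L : ContinuousMultilinearMap 𝕜 (fun _ : Fin m => X) 𝕜} {C : ℝ}
    (h : ∀ x : X, ‖x‖ ≤ 1 → ‖hatPoly L x‖ ≤ C) : hatNorm L ≤ C := by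
  refine csSup_le ⟨_, 0, by simp, rfl⟩ ?_
  rintro _ ⟨y, hy, rfl⟩
  exact h y (by simpa using hy)

lemma hatPoly_smul (L : ContinuousMultilinearMap 𝕜 (fun _ : Fin m => X) 𝕜) (c : 𝕜) (x : X) :
    hatPoly L (c • x) = c ^ m * hatPoly L x := by
  simpa [hatPoly] using L.map_smul_univ (fun _ => c) (fun _ => x)

lemma norm_hatPoly_le (L : ContinuousMultilinearMap 𝕜 (fun _ : Fin m => X) 𝕜) (x : X) :
    ‖hatPoly L x‖ ≤ hatNorm L * ‖x‖ ^ m := by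
  rcases eq_or_ne x 0 with rfl | hx
  · rcases Nat.eq_zero_or_pos m with rfl | hm
    · simpa using norm_hatPoly_le_hatNorm L (x := 0) (by simp)
    · have : hatPoly L (0 : X) = 0 := by
        simpa [hm.ne'] using hatPoly_smul L 0 0
      simp [this, hm.ne']
  have hx' : (0 : ℝ) < ‖x‖ := norm_pos_iff.2 hx
  have hc : ((‖x‖ : ℝ) : 𝕜) ≠ 0 := by exact_mod_cast hx'.ne'
  set y : X := ((‖x‖ : ℝ) : 𝕜)⁻¹ • x with hy
  have hxy : x = ((‖x‖ : ℝ) : 𝕜) • y := by rw [hy, smul_inv_smul₀ hc]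
  have hy1 : ‖y‖ ≤ 1 := by
    rw [hy, norm_smul, norm_inv, RCLike.norm_ofReal, abs_of_pos hx', inv_mul_cancel₀ hx'.ne']
  calc ‖hatPoly L x‖ = ‖x‖ ^ m * ‖hatPoly L y‖ := by
        conv_lhs => rw [hxy]
        rw [hatPoly_smul, norm_mul, norm_pow, RCLike.norm_ofReal, abs_of_pos hx']
    _ ≤ hatNorm L * ‖x‖ ^ m := by
        rw [mul_comm]
        gcongr
        exact norm_hatPoly_le_hatNorm L hy1

lemma bilin_add_left (L : ContinuousMultilinearMap 𝕜 (fun _ : Fin 2 => X) 𝕜) (x y z : X) :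
    L ![x + y, z] = L ![x, z] + L ![y, z] :=
  L.cons_add (M := fun _ => X) ![z] x y

lemma bilin_smul_left (L : ContinuousMultilinearMap 𝕜 (fun _ : Fin 2 => X) 𝕜) (c : 𝕜) (x z : X) :
    L ![c • x, z] = c * L ![x, z] := by
  have h := L.cons_smul (M := fun _ => X) ![z] c x
  simpa using h

lemma IsSymmForm.swap {L : ContinuousMultilinearMap 𝕜 (fun _ : Fin 2 => X) 𝕜} (hL : IsSymmForm L)
    (x y : X) : L ![x, y] = L ![y, x] := by
  rw [← hL (Equiv.swap 0 1) ![y, x]]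
  congr 1
  ext i
  fin_cases i <;> rfl

lemma hatPoly_two (L : ContinuousMultilinearMap 𝕜 (fun _ : Fin 2 => X) 𝕜) (x : X) :
    hatPoly L x = L ![x, x] := by
  rw [hatPoly]
  congr 1
  ext i
  fin_cases i <;> rfl

lemma IsSymmForm.polarization {L : ContinuousMultilinearMap 𝕜 (fun _ : Fin 2 => X) 𝕜}
    (hL : IsSymmForm L) (x y : X) :
    4 * L ![x, y] = hatPoly L (x + y) - hatPoly L (x - y) := by
  have hsub : x - y = x + (-1 : 𝕜) • y := by simp [sub_eq_add_neg]
  rw [hatPoly_two, hatPoly_two, hsub, bilin_add_left, bilin_add_left, bilin_smul_left,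
    hL.swap x (x + y), hL.swap y (x + y), hL.swap x (x + _), hL.swap y (x + _)]
  simp only [bilin_add_left, bilin_smul_left]
  rw [hL.swap y x]
  ring

lemma opNorm_le_of_unit_ball {L : ContinuousMultilinearMap 𝕜 (fun _ : Fin 2 => X) 𝕜}
    (hL : IsSymmForm L) {C : ℝ} (hC : 0 ≤ C)
    (h : ∀ x y : X, ‖x‖ ≤ 1 → ‖y‖ ≤ 1 → ‖L ![x, y]‖ ≤ C) : ‖L‖ ≤ C := by
  have key : ∀ x y : X, ‖L ![x, y]‖ ≤ C * (‖x‖ * ‖y‖) := by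
    have hz : ∀ y : X, L ![0, y] = 0 := fun y => by
      simpa using bilin_smul_left L 0 0 y
    intro x y
    rcases eq_or_ne x 0 with rfl | hx
    · simp [hz]
    rcases eq_or_ne y 0 with rfl | hy
    · rw [hL.swap]; simp [hz]
    have norm1 : ∀ z : X, z ≠ 0 → ‖((‖z‖ : ℝ) : 𝕜)⁻¹ • z‖ ≤ 1 := fun z hz => by
      rw [norm_smul, norm_inv, RCLike.norm_ofReal, abs_norm,
        inv_mul_cancel₀ (norm_ne_zero_iff.2 hz)]
    have := h _ _ (norm1 x hx) (norm1 y hy)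
    rw [bilin_smul_left, hL.swap, bilin_smul_left, hL.swap, norm_mul, norm_mul, norm_inv, norm_inv,
      RCLike.norm_ofReal, RCLike.norm_ofReal, abs_norm, abs_norm] at this
    have hx' := norm_pos_iff.2 hx
    have hy' := norm_pos_iff.2 hy
    rw [← mul_assoc, ← mul_inv, inv_mul_le_iff₀ (by positivity)] at this
    linarith
  refine ContinuousMultilinearMap.opNorm_le_bound hC fun z => ?_
  have hz : z = ![z 0, z 1] := by ext i; fin_cases i <;> rfl
  rw [Fin.prod_univ_two, hz]
  simpa using key (z 0) (z 1)

lemma norm_bilin_le (L : ContinuousMultilinearMap 𝕜 (fun _ : Fin 2 => X) 𝕜) (x y : X) :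
    ‖L ![x, y]‖ ≤ ‖L‖ * (‖x‖ * ‖y‖) := by
  simpa [Fin.prod_univ_two] using L.le_opNorm ![x, y]

/-- A von Neumann–Jordan type inequality on the unit ball bounds symmetric bilinear forms by
their quadratic forms. -/
lemma IsSymmForm.opNorm_le_mul_hatNorm {C : ℝ}
    (h : ∀ x y : X, ‖x‖ ≤ 1 → ‖y‖ ≤ 1 → ‖x + y‖ ^ 2 + ‖x - y‖ ^ 2 ≤ 4 * C)
    {L : ContinuousMultilinearMap 𝕜 (fun _ : Fin 2 => X) 𝕜} (hL : IsSymmForm L) :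
    ‖L‖ ≤ C * hatNorm L := by
  have hC : 0 ≤ C := by
    have := h 0 0 (by simp) (by simp)
    simp at this
    exact this
  refine opNorm_le_of_unit_ball hL (mul_nonneg hC (hatNorm_nonneg L)) fun x y hx hy => ?_
  have h4 : 4 * ‖L ![x, y]‖ = ‖hatPoly L (x + y) - hatPoly L (x - y)‖ := by
    rw [← hL.polarization, norm_mul]; simp
  have h1 := norm_hatPoly_le L (x + y)
  have h2 := norm_hatPoly_le L (x - y)
  have h3 := norm_sub_le (hatPoly L (x + y)) (hatPoly L (x - y))
  have h5 := mul_le_mul_of_nonneg_left (h x y hx hy) (hatNorm_nonneg L)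
  linarith

lemma polConst_le_ofReal {C : ℝ} (hC : 0 < C)
    (h : ∀ L : ContinuousMultilinearMap 𝕜 (fun _ : Fin m => X) 𝕜,
      IsSymmForm L → ‖L‖ ≤ C * hatNorm L) : polConst 𝕜 m X ≤ ENNReal.ofReal C := by
  refine iInf₂_le (ι := ℝ≥0) C.toNNReal ⟨Real.toNNReal_pos.2 hC, fun L hL => ?_⟩
  rw [Real.coe_toNNReal _ hC.le]
  exact h L hL

lemma ofReal_le_polConst {C : ℝ} {L : ContinuousMultilinearMap 𝕜 (fun _ : Fin m => X) 𝕜}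
    (hL : IsSymmForm L) (h0 : 0 < hatNorm L) (h : ‖L‖ = C * hatNorm L) :
    ENNReal.ofReal C ≤ polConst 𝕜 m X := by
  refine le_iInf₂ fun M hM => ENNReal.ofReal_le_of_le_toReal ?_
  have := hM.2 L hL
  rw [h] at this
  simpa using le_of_mul_le_mul_right this h0

/-- A form on `X` is carried to `Y` by `e.symm`; of the equalities between norms, only the two
inequalities needed are proved. -/
lemma polConst_le_of_linearIsometryEquiv (e : X ≃ₗᵢ[𝕜] Y) : polConst 𝕜 m X ≤ polConst 𝕜 m Y := by
  refine le_iInf₂ fun M hM => iInf₂_le (ι := ℝ≥0) M ⟨hM.1, fun L hL => ?_⟩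
  set L' : ContinuousMultilinearMap 𝕜 (fun _ : Fin m => Y) 𝕜 :=
    L.compContinuousLinearMap fun _ => (e.symm.toContinuousLinearEquiv : Y →L[𝕜] X) with hL'
  have happ : ∀ y, L' y = L fun i => e.symm (y i) := fun y => rfl
  have hs : IsSymmForm L' := fun σ y => hL σ fun i => e.symm (y i)
  have h1 : ‖L‖ ≤ ‖L'‖ := by
    refine ContinuousMultilinearMap.opNorm_le_bound (norm_nonneg _) fun x => ?_
    simpa [happ] using L'.le_opNorm fun i => e (x i)
  have h2 : hatNorm L' ≤ hatNorm L := hatNorm_le fun y hy =>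
    norm_hatPoly_le_hatNorm L (x := e.symm y) (by simpa using hy)
  exact h1.trans ((hM.2 L' hs).trans (by gcongr))

end Polarization

/-! ### Von Neumann–Jordan type inequalities in `L_p`. -/

section VonNeumannJordan

lemma norm_add_sq_add_norm_sub_sq {𝕜 : Type*} [RCLike 𝕜] (a b : 𝕜) :
    ‖a + b‖ ^ 2 + ‖a - b‖ ^ 2 = 2 * (‖a‖ ^ 2 + ‖b‖ ^ 2) := by
  have h := parallelogram_law_with_norm 𝕜 a b
  nlinarith [h]

lemma sq_rpow_half {a : ℝ} (ha : 0 ≤ a) (q : ℝ) : (a ^ 2) ^ (q / 2) = a ^ q := by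
  rw [← Real.rpow_natCast, ← Real.rpow_mul ha]
  congr 1
  push_cast
  ring

lemma rpow_add_le_two_rpow_mul {a b q : ℝ} (ha : 0 ≤ a) (hb : 0 ≤ b) (hq : 1 ≤ q) :
    (a + b) ^ q ≤ 2 ^ (q - 1) * (a ^ q + b ^ q) := by
  lift a to ℝ≥0 using ha
  lift b to ℝ≥0 using hb
  exact_mod_cast NNReal.rpow_add_le_mul_rpow_add_rpow a b hq

/-- Superadditivity of `t ^ (q / 2)` reduces the left side to the parallelogram law, and convexity
of the same function splits `‖a‖² + ‖b‖²`. -/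
lemma norm_add_rpow_add_norm_sub_rpow_le {𝕜 : Type*} [RCLike 𝕜] {q : ℝ} (hq : 2 ≤ q) (a b : 𝕜) :
    ‖a + b‖ ^ q + ‖a - b‖ ^ q ≤ 2 ^ (q - 1) * (‖a‖ ^ q + ‖b‖ ^ q) := by
  have hq2 : 1 ≤ q / 2 := by linarith
  have h1 := Real.add_rpow_le_rpow_add (sq_nonneg ‖a + b‖) (sq_nonneg ‖a - b‖) hq2
  have h2 := rpow_add_le_two_rpow_mul (sq_nonneg ‖a‖) (sq_nonneg ‖b‖) hq2
  rw [norm_add_sq_add_norm_sub_sq, Real.mul_rpow (by norm_num) (by positivity)] at h1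
  simp only [sq_rpow_half (norm_nonneg _)] at h1 h2
  calc _ ≤ _ := h1
    _ ≤ 2 ^ (q / 2) * (2 ^ (q / 2 - 1) * (‖a‖ ^ q + ‖b‖ ^ q)) := by gcongr
    _ = _ := by
      rw [← mul_assoc, ← Real.rpow_add (by norm_num)]
      ring_nf

/-- Hölder with exponents `2 / (2 - q)` and `2 / q`, then the parallelogram law and subadditivity of
`t ^ (q / 2)`. The weights are there to be `‖x + y‖` and `‖x - y‖` after integration, which turns
the `q`-th powers into squares. -/
lemma weighted_norm_add_rpow_le {𝕜 : Type*} [RCLike 𝕜] {q : ℝ} (hq1 : 1 ≤ q) (hq2 : q < 2)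
    {α β : ℝ} (hα : 0 ≤ α) (hβ : 0 ≤ β) (a b : 𝕜) :
    α ^ (2 - q) * ‖a + b‖ ^ q + β ^ (2 - q) * ‖a - b‖ ^ q ≤
      (α ^ 2 + β ^ 2) ^ (1 - q / 2) * (2 ^ (q / 2) * (‖a‖ ^ q + ‖b‖ ^ q)) := by
  have hq : 0 < q := by linarith
  have hq' : 0 < 2 - q := by linarith
  have hconj : (2 / (2 - q)).HolderConjugate (2 / q) := by
    rw [Real.holderConjugate_iff]
    constructor
    · rw [lt_div_iff₀ hq']; linarith
    · field_simp; ring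
  have h := Real.inner_le_Lp_mul_Lq_of_nonneg Finset.univ hconj
    (f := ![α ^ (2 - q), β ^ (2 - q)]) (g := ![‖a + b‖ ^ q, ‖a - b‖ ^ q])
    (by intro i _; fin_cases i <;> simp <;> positivity)
    (by intro i _; fin_cases i <;> simp <;> positivity)
  have e1 : ∀ t : ℝ, 0 ≤ t → (t ^ (2 - q)) ^ (2 / (2 - q)) = t ^ 2 := fun t ht => by
    rw [← Real.rpow_mul ht, mul_div_cancel₀ _ hq'.ne', Real.rpow_two]
  have e2 : ∀ t : ℝ, 0 ≤ t → (t ^ q) ^ (2 / q) = t ^ 2 := fun t ht => by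
    rw [← Real.rpow_mul ht, mul_div_cancel₀ _ hq.ne', Real.rpow_two]
  simp only [Fin.sum_univ_two, Matrix.cons_val_zero, Matrix.cons_val_one, e1 _ hα, e1 _ hβ,
    e2 _ (norm_nonneg _), one_div_div, norm_add_sq_add_norm_sub_sq] at h
  refine h.trans ?_
  rw [show (2 - q) / 2 = 1 - q / 2 by ring, Real.mul_rpow (by norm_num) (by positivity)]
  have h3 := Real.rpow_add_le_add_rpow (sq_nonneg ‖a‖) (sq_nonneg ‖b‖)
    (show 0 ≤ q / 2 by linarith) (by linarith)
  simp only [sq_rpow_half (norm_nonneg _)] at h3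
  gcongr

variable {𝕜 : Type*} [RCLike 𝕜] {Ω : Type*} [MeasurableSpace Ω] {μ : Measure Ω} {p : ℝ≥0∞}

lemma Lp_integrable_norm_rpow (hp0 : p ≠ 0) (hp : p ≠ ∞) (f : Lp 𝕜 p μ) :
    Integrable (fun ω => ‖f ω‖ ^ p.toReal) μ :=
  (Lp.memLp f).integrable_norm_rpow hp0 hp

lemma Lp_norm_rpow_eq_integral (hp0 : p ≠ 0) (hp : p ≠ ∞) (f : Lp 𝕜 p μ) :
    ‖f‖ ^ p.toReal = ∫ ω, ‖f ω‖ ^ p.toReal ∂μ := by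
  have hp' := ENNReal.toReal_pos hp0 hp
  have h0 : 0 ≤ ∫ ω, ‖f ω‖ ^ p.toReal ∂μ := integral_nonneg fun _ => by positivity
  rw [Lp.norm_def, (Lp.memLp f).eLpNorm_eq_integral_rpow_norm hp0 hp,
    ENNReal.toReal_ofReal (by positivity), ← Real.rpow_mul h0, inv_mul_cancel₀ hp'.ne',
    Real.rpow_one]

lemma Lp_weighted_norm_add_rpow_le (hp0 : p ≠ 0) (hp : p ≠ ∞) {A B C : ℝ}
    (h : ∀ a b : 𝕜, A * ‖a + b‖ ^ p.toReal + B * ‖a - b‖ ^ p.toReal ≤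
      C * (‖a‖ ^ p.toReal + ‖b‖ ^ p.toReal)) (x y : Lp 𝕜 p μ) :
    A * ‖x + y‖ ^ p.toReal + B * ‖x - y‖ ^ p.toReal ≤
      C * (‖x‖ ^ p.toReal + ‖y‖ ^ p.toReal) := by
  have hi := Lp_integrable_norm_rpow (𝕜 := 𝕜) (μ := μ) hp0 hp
  simp only [Lp_norm_rpow_eq_integral hp0 hp]
  rw [← integral_const_mul, ← integral_const_mul, ← integral_add (hi x) (hi y),
    ← integral_add ((hi _).const_mul A) ((hi _).const_mul B), ← integral_const_mul]
  refine integral_mono_ae (((hi _).const_mul A).add ((hi _).const_mul B))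
    (((hi x).add (hi y)).const_mul C) ?_
  filter_upwards [Lp.coeFn_add x y, Lp.coeFn_sub x y] with ω h1 h2
  rw [h1, h2]
  exact h (x ω) (y ω)

lemma Lp_norm_add_sq_add_norm_sub_sq_le_of_lt_two (hp1 : 1 ≤ p.toReal) (hp2 : p.toReal < 2)
    [Fact (1 ≤ p)] (x y : Lp 𝕜 p μ) (hx : ‖x‖ ≤ 1) (hy : ‖y‖ ≤ 1) :
    ‖x + y‖ ^ 2 + ‖x - y‖ ^ 2 ≤ 4 * 2 ^ ((2 - p.toReal) / p.toReal) := by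
  obtain ⟨hp0, hp⟩ : p ≠ 0 ∧ p ≠ ∞ := by
    constructor <;> rintro rfl <;> norm_num at hp1
  set q := p.toReal with hq
  have hq0 : 0 < q := by linarith
  set S := ‖x + y‖ ^ 2 + ‖x - y‖ ^ 2 with hS
  have hS0 : 0 ≤ S := by positivity
  rcases hS0.eq_or_lt with h0 | hSpos
  -- `S` must be positive because a power of it is cancelled below.
  · rw [← h0]; positivity
  have h := Lp_weighted_norm_add_rpow_le (μ := μ) hp0 hp
    (A := ‖x + y‖ ^ (2 - q)) (B := ‖x - y‖ ^ (2 - q)) (C := S ^ (1 - q / 2) * 2 ^ (q / 2))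
    (fun a b : 𝕜 => (weighted_norm_add_rpow_le hp1 hp2 (norm_nonneg _) (norm_nonneg _) a b).trans_eq
      (mul_assoc _ _ _).symm) x y
  have e : ∀ t : ℝ, 0 ≤ t → t ^ (2 - q) * t ^ q = t ^ 2 := fun t ht => by
    rw [← Real.rpow_add_of_nonneg ht (by linarith) hq0.le, sub_add_cancel, Real.rpow_two]
  rw [e _ (norm_nonneg _), e _ (norm_nonneg _), ← hS] at h
  have hx' : ‖x‖ ^ q ≤ 1 := Real.rpow_le_one (norm_nonneg _) hx hq0.le
  have hy' : ‖y‖ ^ q ≤ 1 := Real.rpow_le_one (norm_nonneg _) hy hq0.le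
  -- With these weights the integrated left side is `S` itself, so the inequality bounds `S` by a
  -- smaller power of `S`.
  have h2 : S ≤ S ^ (1 - q / 2) * 2 ^ (q / 2) * 2 := by
    refine h.trans ?_
    gcongr
    linarith
  have h3 : S ^ (q / 2) ≤ 2 ^ (q / 2 + 1) := by
    have hpos : 0 < S ^ (1 - q / 2) := by positivity
    have hsplit : S = S ^ (1 - q / 2) * S ^ (q / 2) := by
      rw [← Real.rpow_add hSpos]; simp
    rw [Real.rpow_add_one (by norm_num)]
    refine le_of_mul_le_mul_left ?_ hpos
    rw [← hsplit]
    linarith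
  have h4 := Real.rpow_le_rpow (by positivity) h3 (show 0 ≤ 2 / q by positivity)
  rw [← Real.rpow_mul hS0, ← Real.rpow_mul (by norm_num)] at h4
  calc S = S ^ (q / 2 * (2 / q)) := by
        rw [show q / 2 * (2 / q) = 1 by field_simp, Real.rpow_one]
    _ ≤ _ := h4
    _ = 4 * 2 ^ ((2 - q) / q) := by
        rw [show (4 : ℝ) = 2 ^ (2 : ℝ) by norm_num, ← Real.rpow_add (by norm_num)]
        congr 1
        field_simp
        ring

lemma Lp_norm_add_sq_add_norm_sub_sq_le_of_two_le (hp : p ≠ ∞) (hp2 : 2 ≤ p.toReal)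
    [Fact (1 ≤ p)] (x y : Lp 𝕜 p μ) (hx : ‖x‖ ≤ 1) (hy : ‖y‖ ≤ 1) :
    ‖x + y‖ ^ 2 + ‖x - y‖ ^ 2 ≤ 4 * 2 ^ ((p.toReal - 2) / p.toReal) := by
  have hp0 : p ≠ 0 := by rintro rfl; norm_num at hp2
  set q := p.toReal with hq
  have hq0 : 0 < q := by linarith
  set S := ‖x + y‖ ^ 2 + ‖x - y‖ ^ 2 with hS
  have hS0 : 0 ≤ S := by positivity
  have h := Lp_weighted_norm_add_rpow_le (μ := μ) hp0 hp (A := 1) (B := 1)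
    (fun a b : 𝕜 => by
      simpa only [one_mul] using norm_add_rpow_add_norm_sub_rpow_le hp2 a b) x y
  rw [one_mul, one_mul] at h
  have hx' : ‖x‖ ^ q ≤ 1 := Real.rpow_le_one (norm_nonneg _) hx hq0.le
  have hy' : ‖y‖ ^ q ≤ 1 := Real.rpow_le_one (norm_nonneg _) hy hq0.le
  have h2 : ‖x + y‖ ^ q + ‖x - y‖ ^ q ≤ 2 ^ q := by
    refine h.trans ?_
    calc (2 : ℝ) ^ (q - 1) * (‖x‖ ^ q + ‖y‖ ^ q) ≤ 2 ^ (q - 1) * 2 := by gcongr; linarith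
      _ = 2 ^ q := by rw [← Real.rpow_add_one (by norm_num)]; simp
  -- Power means: passing from exponent `q` to exponent `2` costs the extra factor `2 ^ (q / 2 -
  -- 1)`.
  have h3 : S ^ (q / 2) ≤ 2 ^ (q / 2 - 1) * 2 ^ q := by
    have := rpow_add_le_two_rpow_mul (sq_nonneg ‖x + y‖) (sq_nonneg ‖x - y‖)
      (show 1 ≤ q / 2 by linarith)
    simp only [sq_rpow_half (norm_nonneg _)] at this
    refine this.trans ?_
    gcongr
  rw [← Real.rpow_add (by norm_num)] at h3
  have h4 := Real.rpow_le_rpow (by positivity) h3 (show 0 ≤ 2 / q by positivity)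
  rw [← Real.rpow_mul hS0, ← Real.rpow_mul (by norm_num)] at h4
  calc S = S ^ (q / 2 * (2 / q)) := by
        rw [show q / 2 * (2 / q) = 1 by field_simp, Real.rpow_one]
    _ ≤ _ := h4
    _ = 4 * 2 ^ ((q - 2) / q) := by
        rw [show (4 : ℝ) = 2 ^ (2 : ℝ) by norm_num, ← Real.rpow_add (by norm_num)]
        congr 1
        field_simp
        ring

lemma Lp_norm_add_sq_add_norm_sub_sq_le [hp1 : Fact (1 ≤ p)] (x y : Lp 𝕜 p μ) (hx : ‖x‖ ≤ 1)
    (hy : ‖y‖ ≤ 1) : ‖x + y‖ ^ 2 + ‖x - y‖ ^ 2 ≤ 4 * 2 ^ |ratioExp p| := by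
  rcases eq_or_ne p ∞ with rfl | hp
  -- For `p = ∞` the triangle inequality suffices, as the bound is `8`.
  · have h1 : ‖x + y‖ ≤ 2 := (norm_add_le _ _).trans (by linarith)
    have h2 : ‖x - y‖ ≤ 2 := (norm_sub_le _ _).trans (by linarith)
    have h3 := norm_nonneg (x + y)
    have h4 := norm_nonneg (x - y)
    simp only [ratioExp, if_true, abs_one, Real.rpow_one]
    nlinarith
  have hq1 : 1 ≤ p.toReal := by
    rw [← ENNReal.toReal_one]
    exact ENNReal.toReal_mono hp hp1.out
  simp only [ratioExp, if_neg hp]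
  rcases lt_or_ge p.toReal 2 with h | h
  · rw [abs_div, abs_of_neg (by linarith), abs_of_nonneg (by linarith), neg_sub]
    exact Lp_norm_add_sq_add_norm_sub_sq_le_of_lt_two hq1 h x y hx hy
  · rw [abs_of_nonneg (div_nonneg (by linarith) (by linarith))]
    exact Lp_norm_add_sq_add_norm_sub_sq_le_of_two_le hp h x y hx hy

lemma polConst_Lp_le [Fact (1 ≤ p)] : polConst 𝕜 2 (Lp 𝕜 p μ) ≤ (2 : ℝ≥0∞) ^ |ratioExp p| := by
  have h2 : (2 : ℝ≥0∞) = ENNReal.ofReal 2 := by simp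
  rw [h2, ENNReal.ofReal_rpow_of_pos two_pos]
  exact polConst_le_ofReal (by positivity) fun L hL =>
    hL.opNorm_le_mul_hatNorm Lp_norm_add_sq_add_norm_sub_sq_le

end VonNeumannJordan

/-! ### `ℓ_p` as `L_p` of a counting measure. -/

section CountingMeasure

lemma ae_count_iff {Ω : Type*} [MeasurableSpace Ω] [MeasurableSingletonClass Ω] {P : Ω → Prop} :
    (∀ᵐ ω ∂(Measure.count : Measure Ω), P ω) ↔ ∀ ω, P ω := by
  simp [ae_iff, Measure.count_eq_zero_iff, Set.eq_empty_iff_forall_notMem]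

variable {𝕜 : Type*} [RCLike 𝕜] {ι Ω : Type*} [Countable Ω] [MeasurableSpace Ω]
  [DiscreteMeasurableSpace Ω] {p : ℝ≥0∞}

/-- The index type is kept apart from `Ω` because `polConstLp` ranges over `Type u`, so that `ℕ`
enters as `ULift ℕ`. -/
lemma memℓp_comp_iff_memLp_count (hp0 : p ≠ 0) (e : ι ≃ Ω) (g : Ω → 𝕜) :
    Memℓp (g ∘ e) p ↔ MemLp g p (Measure.count : Measure Ω) := by
  have hg : AEStronglyMeasurable g (Measure.count : Measure Ω) :=
    (StronglyMeasurable.of_discrete).aestronglyMeasurable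
  rcases eq_or_ne p ∞ with rfl | hp
  · rw [memℓp_infty_iff]
    constructor
    · rintro ⟨C, hC⟩
      refine memLp_top_of_bound hg C (ae_count_iff.2 fun ω => ?_)
      exact hC ⟨e.symm ω, by simp⟩
    · intro h
      refine ⟨(eLpNorm g ∞ Measure.count).toReal, ?_⟩
      rintro _ ⟨i, rfl⟩
      have := ENNReal.toReal_mono h.2.ne (enorm_le_eLpNorm_count g (e i) hp0)
      simpa using this
  · rw [memℓp_gen_iff (ENNReal.toReal_pos hp0 hp), ← integrable_norm_rpow_iff hg hp0 hp,
      integrable_count_iff, summable_norm_iff]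
    exact e.summable_iff (f := fun ω => ‖g ω‖ ^ p.toReal)

/-- The isometry between `L_p` of the counting measure and `ℓ_p`. -/
noncomputable def lpCountIsometry (𝕜 : Type*) [RCLike 𝕜] (p : ℝ≥0∞) [hp1 : Fact (1 ≤ p)]
    (e : ι ≃ Ω) : Lp 𝕜 p (Measure.count : Measure Ω) →ₗᵢ[𝕜] lp (fun _ : ι => 𝕜) p where
  toFun f := ⟨f ∘ e, (memℓp_comp_iff_memLp_count (zero_lt_one.trans_le hp1.out).ne' e f).2
    (Lp.memLp f)⟩
  map_add' f g := by
    ext i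
    exact ae_count_iff.1 (Lp.coeFn_add f g) (e i)
  map_smul' c f := by
    ext i
    exact ae_count_iff.1 (Lp.coeFn_smul c f) (e i)
  norm_map' f := by
    have hp0 : p ≠ 0 := (zero_lt_one.trans_le hp1.out).ne'
    rcases eq_or_ne p ∞ with rfl | hp
    · rw [lp.norm_eq_ciSup, Lp.norm_def, eLpNorm_exponent_top, eLpNormEssSup_count,
        ENNReal.toReal_iSup fun _ => enorm_ne_top]
      exact (e.surjective.iSup_comp fun ω => ‖f ω‖).trans (by simp)
    · have hq := ENNReal.toReal_pos hp0 hp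
      rw [← Real.rpow_left_inj (norm_nonneg _) (norm_nonneg _) hq.ne', lp.norm_rpow_eq_tsum hq,
        Lp_norm_rpow_eq_integral hp0 hp, integral_countable (Lp_integrable_norm_rpow hp0 hp f)]
      simpa [Measure.real] using e.tsum_eq fun ω => ‖f ω‖ ^ p.toReal

lemma lpCountIsometry_surjective [hp1 : Fact (1 ≤ p)] (e : ι ≃ Ω) :
    Function.Surjective (lpCountIsometry 𝕜 p e) := by
  intro g
  have h : MemLp ((g : ι → 𝕜) ∘ e.symm) p (Measure.count : Measure Ω) := by
    rw [← memℓp_comp_iff_memLp_count (zero_lt_one.trans_le hp1.out).ne' e]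
    simpa [Function.comp_assoc] using lp.memℓp g
  refine ⟨h.toLp _, ?_⟩
  ext i
  exact (ae_count_iff.1 h.coeFn_toLp (e i)).trans (by simp)

lemma polConst_Lp_count [Fact (1 ≤ p)] (m : ℕ) (e : ι ≃ Ω) :
    polConst 𝕜 m (Lp 𝕜 p (Measure.count : Measure Ω)) = polConst 𝕜 m (lp (fun _ : ι => 𝕜) p) := by
  let E := LinearIsometryEquiv.ofSurjective _ (lpCountIsometry_surjective (𝕜 := 𝕜) (p := p) e)
  exact le_antisymm (polConst_le_of_linearIsometryEquiv E)
    (polConst_le_of_linearIsometryEquiv E.symm)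

instance : DiscreteMeasurableSpace (ULift.{u} ℕ) :=
  ⟨fun s => (MeasurableSet.of_discrete : MeasurableSet (ULift.up ⁻¹' s))⟩

lemma polConst_lp_nat_le_polConstLp (𝕜 : Type v) [RCLike 𝕜] (m : ℕ) (p : ℝ≥0∞) [Fact (1 ≤ p)] :
    polConst 𝕜 m (lp (fun _ : ℕ => 𝕜) p) ≤ polConstLp.{u} 𝕜 m p := by
  rw [← polConst_Lp_count m (Equiv.ulift.{u} (α := ℕ)).symm]
  exact le_iSup₂_of_le (ULift.{u} ℕ) inferInstance
    (le_iSup (fun μ : Measure (ULift.{u} ℕ) => polConst 𝕜 m (Lp 𝕜 p μ)) Measure.count)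

lemma polConstLp_le (𝕜 : Type v) [RCLike 𝕜] (p : ℝ≥0∞) [Fact (1 ≤ p)] :
    polConstLp.{u} 𝕜 2 p ≤ (2 : ℝ≥0∞) ^ |ratioExp p| :=
  iSup_le fun _ => iSup₂_le fun _ _ => polConst_Lp_le

lemma lp_norm_add_sq_add_norm_sub_sq_le [Fact (1 ≤ p)] (x y : lp (fun _ : ℕ => 𝕜) p)
    (hx : ‖x‖ ≤ 1) (hy : ‖y‖ ≤ 1) : ‖x + y‖ ^ 2 + ‖x - y‖ ^ 2 ≤ 4 * 2 ^ |ratioExp p| := by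
  obtain ⟨f, rfl⟩ := lpCountIsometry_surjective (Equiv.refl ℕ) x
  obtain ⟨g, rfl⟩ := lpCountIsometry_surjective (Equiv.refl ℕ) y
  rw [LinearIsometry.norm_map] at hx hy
  rw [← map_add, ← map_sub, LinearIsometry.norm_map, LinearIsometry.norm_map]
  exact Lp_norm_add_sq_add_norm_sub_sq_le f g hx hy

end CountingMeasure

/-! ### Forms attaining the bound. -/

section ExtremalForms

variable {p : ℝ≥0∞}

/-- The case `p = ∞` is included because `∞.toReal = 0` and `2 / 0 = 0`. -/
lemma ratioExp_eq (hp0 : p ≠ 0) : ratioExp p = 1 - 2 / p.toReal := by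
  rcases eq_or_ne p ∞ with rfl | hp
  · simp [ratioExp]
  · have := (ENNReal.toReal_pos hp0 hp).ne'
    rw [ratioExp, if_neg hp]
    field_simp

lemma abs_ratioExp_of_le_two (hp2 : p ≤ 2) : |ratioExp p| = (2 - p.toReal) / p.toReal := by
  have hp : p ≠ ∞ := ne_top_of_le_ne_top ENNReal.ofNat_ne_top hp2
  have h2 : p.toReal ≤ 2 := by simpa using ENNReal.toReal_mono ENNReal.ofNat_ne_top hp2
  rw [ratioExp, if_neg hp, abs_div, abs_of_nonpos (by linarith), abs_of_nonneg (by simp), neg_sub]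

lemma ratioExp_nonneg (hp2 : 2 ≤ p) : 0 ≤ ratioExp p := by
  rw [ratioExp]
  split_ifs with hp
  · exact zero_le_one
  · have h2 : 2 ≤ p.toReal := by simpa using ENNReal.toReal_mono hp hp2
    exact div_nonneg (by linarith) (by linarith)

lemma two_rpow_mul_two_rpow_neg_two_div (hp0 : p ≠ 0) (hp : p ≠ ∞) :
    (2 : ℝ) ^ ((2 - p.toReal) / p.toReal) * 2 ^ (-2 / p.toReal) = 1 / 2 := by
  have hq := (ENNReal.toReal_pos hp0 hp).ne'
  rw [← Real.rpow_add two_pos,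
    show (2 - p.toReal) / p.toReal + -2 / p.toReal = -1 by field_simp; ring, Real.rpow_neg_one]
  norm_num

variable {𝕜 : Type*} [RCLike 𝕜] [hp1 : Fact (1 ≤ p)]

/-- The bilinear form `(x, y) ↦ x i * y j` on `ℓ_p`. -/
noncomputable def coordForm (𝕜 : Type*) [RCLike 𝕜] (p : ℝ≥0∞) [Fact (1 ≤ p)] (i j : ℕ) :
    ContinuousMultilinearMap 𝕜 (fun _ : Fin 2 => lp (fun _ : ℕ => 𝕜) p) 𝕜 :=
  (ContinuousMultilinearMap.mkPiAlgebra 𝕜 (Fin 2) 𝕜).compContinuousLinearMap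
    ![lp.evalCLM 𝕜 (fun _ : ℕ => 𝕜) p i, lp.evalCLM 𝕜 (fun _ : ℕ => 𝕜) p j]

lemma coordForm_apply (i j : ℕ) (x : Fin 2 → lp (fun _ : ℕ => 𝕜) p) :
    coordForm 𝕜 p i j x = x 0 i * x 1 j := by
  simp only [coordForm, ContinuousMultilinearMap.compContinuousLinearMap_apply,
    ContinuousMultilinearMap.mkPiAlgebra_apply, Fin.prod_univ_two]
  rfl

lemma isSymmForm_of_swap {X : Type*} [NormedAddCommGroup X] [NormedSpace 𝕜 X]
    {L : ContinuousMultilinearMap 𝕜 (fun _ : Fin 2 => X) 𝕜}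
    (h : ∀ x : Fin 2 → X, L (fun i => x (Equiv.swap 0 1 i)) = L x) : IsSymmForm L := by
  intro σ x
  have hσ : σ = 1 ∨ σ = Equiv.swap 0 1 := by revert σ; decide
  rcases hσ with rfl | rfl
  · rfl
  · exact h x

lemma lp_norm_single_add_single_le (s : 𝕜) (hs : ‖s‖ ≤ 1) :
    ‖lp.single (E := fun _ : ℕ => 𝕜) p 0 1 + lp.single p 1 s‖ ≤ 2 ^ (1 / p.toReal) := by
  have hp0 : p ≠ 0 := (zero_lt_one.trans_le hp1.out).ne'
  rcases eq_or_ne p ∞ with rfl | hp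
  · simp only [ENNReal.toReal_top, div_zero, Real.rpow_zero]
    refine lp.norm_le_of_forall_le zero_le_one fun i => ?_
    rcases i with _ | _ | i <;> simp [lp.single_apply, hs]
  · have hq := ENNReal.toReal_pos hp0 hp
    have h := lp.norm_sum_single (E := fun _ : ℕ => 𝕜) hq
      (fun i => if i = 0 then 1 else s) {0, 1}
    rw [Finset.sum_pair zero_ne_one, Finset.sum_pair zero_ne_one] at h
    simp only [if_true, one_ne_zero, if_false, norm_one, Real.one_rpow] at h
    rw [← Real.rpow_le_rpow_iff (norm_nonneg _) (by positivity) hq, h, ← Real.rpow_mul two_pos.le,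
      one_div_mul_cancel hq.ne', Real.rpow_one]
    have := Real.rpow_le_one (norm_nonneg s) hs hq.le
    linarith

lemma lp_form_opNorm_le {L : ContinuousMultilinearMap 𝕜 (fun _ : Fin 2 => lp (fun _ : ℕ => 𝕜) p) 𝕜}
    (hL : IsSymmForm L) : ‖L‖ ≤ 2 ^ |ratioExp p| * hatNorm L :=
  hL.opNorm_le_mul_hatNorm lp_norm_add_sq_add_norm_sub_sq_le

/-- Both constants lie between the ratio realised by `L` and the upper bound for all `L_p(μ)`. -/
lemma polConst_eq_of_extremal {𝕜 : Type v} [RCLike 𝕜] {c : ℝ} (hc : |ratioExp p| = c)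
    {L : ContinuousMultilinearMap 𝕜 (fun _ : Fin 2 => lp (fun _ : ℕ => 𝕜) p) 𝕜}
    (hL : IsSymmForm L) (h0 : 0 < hatNorm L) (h : ‖L‖ = 2 ^ c * hatNorm L) :
    polConstLp.{u} 𝕜 2 p = (2 : ℝ≥0∞) ^ c ∧
      polConst 𝕜 2 (lp (fun _ : ℕ => 𝕜) p) = (2 : ℝ≥0∞) ^ c := by
  have h1 := polConstLp_le.{u} 𝕜 p
  have h2 := polConst_lp_nat_le_polConstLp.{u} 𝕜 2 p
  have h3 := ofReal_le_polConst hL h0 h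
  rw [← ENNReal.ofReal_rpow_of_pos two_pos, ENNReal.ofReal_ofNat] at h3
  rw [hc] at h1
  exact ⟨le_antisymm h1 (h3.trans h2), le_antisymm (h2.trans h1) h3⟩

/-- The form `(x, y) ↦ (x 0 * y 1 + x 1 * y 0) / 2` on `ℓ_p`. -/
noncomputable def hyperbolicForm (𝕜 : Type*) [RCLike 𝕜] (p : ℝ≥0∞) [Fact (1 ≤ p)] :
    ContinuousMultilinearMap 𝕜 (fun _ : Fin 2 => lp (fun _ : ℕ => 𝕜) p) 𝕜 :=
  (1 / 2 : 𝕜) • (coordForm 𝕜 p 0 1 + coordForm 𝕜 p 1 0)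

lemma hyperbolicForm_apply (x : Fin 2 → lp (fun _ : ℕ => 𝕜) p) :
    hyperbolicForm 𝕜 p x = (1 / 2 : 𝕜) * (x 0 0 * x 1 1 + x 0 1 * x 1 0) := by
  simp [hyperbolicForm, coordForm_apply, mul_add]

lemma isSymmForm_hyperbolicForm : IsSymmForm (hyperbolicForm 𝕜 p) :=
  isSymmForm_of_swap fun x => by
    simp only [hyperbolicForm_apply, Equiv.swap_apply_left, Equiv.swap_apply_right]
    ring

lemma hatPoly_hyperbolicForm (x : lp (fun _ : ℕ => 𝕜) p) :
    hatPoly (hyperbolicForm 𝕜 p) x = x 0 * x 1 := by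
  rw [hatPoly, hyperbolicForm_apply]
  ring

lemma half_le_norm_hyperbolicForm : 1 / 2 ≤ ‖hyperbolicForm 𝕜 p‖ := by
  have hp0 : 0 < p := zero_lt_one.trans_le hp1.out
  have h := norm_bilin_le (hyperbolicForm 𝕜 p) (lp.single p 0 1) (lp.single p 1 1)
  simpa [hyperbolicForm_apply, lp.norm_single hp0, lp.single_apply] using h

lemma hatNorm_hyperbolicForm (hp : p ≠ ∞) :
    hatNorm (hyperbolicForm 𝕜 p) = 2 ^ (-2 / p.toReal) := by
  have hq := ENNReal.toReal_pos (zero_lt_one.trans_le hp1.out).ne' hp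
  apply le_antisymm
  · refine hatNorm_le fun x hx => ?_
    rw [hatPoly_hyperbolicForm, norm_mul]
    have h1 := lp.sum_rpow_le_norm_rpow hq x {0, 1}
    rw [Finset.sum_pair zero_ne_one] at h1
    have h2 := h1.trans (Real.rpow_le_one (norm_nonneg _) hx hq.le)
    -- After raising to the power `p`, this is AM-GM: `ab ≤ 1/4` when `a + b ≤ 1`.
    rw [← Real.rpow_le_rpow_iff (by positivity) (by positivity) hq,
      Real.mul_rpow (norm_nonneg _) (norm_nonneg _), ← Real.rpow_mul two_pos.le,
      div_mul_cancel₀ _ hq.ne', Real.rpow_neg two_pos.le, Real.rpow_two]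
    have ha : 0 ≤ ‖x 0‖ ^ p.toReal := by positivity
    have hb : 0 ≤ ‖x 1‖ ^ p.toReal := by positivity
    nlinarith [sq_nonneg (‖x 0‖ ^ p.toReal - ‖x 1‖ ^ p.toReal)]
  · set z := lp.single (E := fun _ : ℕ => 𝕜) p 0 1 + lp.single p 1 1 with hz
    have h1 := norm_hatPoly_le (hyperbolicForm 𝕜 p) z
    have h2 : hatPoly (hyperbolicForm 𝕜 p) z = 1 := by
      simp [hatPoly_hyperbolicForm, hz, lp.single_apply]
    rw [h2, norm_one] at h1
    have h3 : ‖z‖ ^ 2 ≤ 2 ^ (2 / p.toReal) := by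
      have := pow_le_pow_left₀ (norm_nonneg _)
        (lp_norm_single_add_single_le (p := p) (1 : 𝕜) (by simp)) 2
      rwa [← Real.rpow_mul_natCast two_pos.le, Nat.cast_ofNat, div_mul_eq_mul_div, one_mul] at this
    rw [neg_div, Real.rpow_neg two_pos.le, inv_le_iff_one_le_mul₀ (by positivity)]
    exact h1.trans (mul_le_mul_of_nonneg_left h3 (hatNorm_nonneg _))

lemma norm_hyperbolicForm (hp2 : p ≤ 2) : ‖hyperbolicForm 𝕜 p‖ = 1 / 2 := by
  have hp : p ≠ ∞ := ne_top_of_le_ne_top ENNReal.ofNat_ne_top hp2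
  refine le_antisymm ?_ half_le_norm_hyperbolicForm
  -- The general estimate gives the upper bound: `2 ^ ((2 - p) / p) * 2 ^ (-2 / p) = 1 / 2`.
  have h := lp_form_opNorm_le (isSymmForm_hyperbolicForm (𝕜 := 𝕜) (p := p))
  rwa [abs_ratioExp_of_le_two hp2, hatNorm_hyperbolicForm hp,
    two_rpow_mul_two_rpow_neg_two_div (zero_lt_one.trans_le hp1.out).ne' hp] at h

/-- The form `(x, y) ↦ x 0 * y 0 - x 1 * y 1` on real `ℓ_p`. -/
noncomputable def differenceForm (p : ℝ≥0∞) [Fact (1 ≤ p)] :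
    ContinuousMultilinearMap ℝ (fun _ : Fin 2 => lp (fun _ : ℕ => ℝ) p) ℝ :=
  coordForm ℝ p 0 0 - coordForm ℝ p 1 1

lemma differenceForm_apply (x : Fin 2 → lp (fun _ : ℕ => ℝ) p) :
    differenceForm p x = x 0 0 * x 1 0 - x 0 1 * x 1 1 := by
  simp [differenceForm, coordForm_apply]

lemma isSymmForm_differenceForm : IsSymmForm (differenceForm p) :=
  isSymmForm_of_swap fun x => by
    simp only [differenceForm_apply, Equiv.swap_apply_left, Equiv.swap_apply_right]
    ring

lemma hatPoly_differenceForm (x : lp (fun _ : ℕ => ℝ) p) :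
    hatPoly (differenceForm p) x = x 0 ^ 2 - x 1 ^ 2 := by
  rw [hatPoly, differenceForm_apply]
  ring

lemma hatNorm_differenceForm : hatNorm (differenceForm p) = 1 := by
  have hp0 : 0 < p := zero_lt_one.trans_le hp1.out
  apply le_antisymm
  · refine hatNorm_le fun x hx => ?_
    -- Real scalars matter here: both squares lie in `[0, 1]`, hence so does the modulus of their
    -- difference.
    have h : ∀ i, x i ^ 2 ≤ 1 := fun i => by
      rw [sq_le_one_iff_abs_le_one, ← Real.norm_eq_abs]
      exact (lp.norm_apply_le_norm hp0.ne' x i).trans hx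
    rw [hatPoly_differenceForm, Real.norm_eq_abs, abs_le]
    constructor <;> linarith [h 0, h 1, sq_nonneg (x 0), sq_nonneg (x 1)]
  · have h := norm_hatPoly_le_hatNorm (differenceForm p)
      (x := lp.single p 0 1) (by simp [lp.norm_single hp0])
    simpa [hatPoly_differenceForm, lp.single_apply] using h

lemma norm_differenceForm (hp2 : 2 ≤ p) : ‖differenceForm p‖ = 2 ^ ratioExp p := by
  have hp0 : p ≠ 0 := (zero_lt_one.trans_le hp1.out).ne'
  apply le_antisymm
  · simpa [abs_of_nonneg (ratioExp_nonneg hp2), hatNorm_differenceForm] using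
      lp_form_opNorm_le (isSymmForm_differenceForm (p := p))
  -- The vectors `e₀ + e₁` and `e₀ - e₁` have norm at most `2 ^ (1 / p)`, and the form equals `2` on
  -- them.
  · have h := norm_bilin_le (differenceForm p)
      (lp.single p 0 1 + lp.single p 1 1) (lp.single p 0 1 + lp.single p 1 (-1))
    have h2 : differenceForm p ![lp.single p 0 1 + lp.single p 1 1,
        lp.single p 0 1 + lp.single p 1 (-1)] = 2 := by
      simp [differenceForm_apply, lp.single_apply]
      norm_num
    rw [h2, Real.norm_ofNat] at h
    have h3 := mul_le_mul (lp_norm_single_add_single_le (p := p) (1 : ℝ) (by simp))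
      (lp_norm_single_add_single_le (p := p) (-1 : ℝ) (by simp)) (norm_nonneg _) (by positivity)
    rw [← Real.rpow_add two_pos, ← add_div, one_add_one_eq_two] at h3
    rw [ratioExp_eq hp0, Real.rpow_sub two_pos, Real.rpow_one, div_le_iff₀ (by positivity)]
    exact h.trans (mul_le_mul_of_nonneg_left h3 (norm_nonneg _))

end ExtremalForms

theorem mainTheorem5 :
    -- upper estimate, real and complex scalars, `1 ≤ p ≤ ∞`
    (∀ (𝕜 : Type) [RCLike 𝕜] (p : ℝ≥0∞) [Fact (1 ≤ p)],
      polConstLp.{u} 𝕜 2 p ≤ (2 : ℝ≥0∞) ^ |ratioExp p|) ∧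
    -- real and complex scalars, `1 ≤ p ≤ 2`
    (∀ (𝕜 : Type) [RCLike 𝕜] (p : ℝ≥0∞) [Fact (1 ≤ p)], p ≤ 2 →
      polConstLp.{u} 𝕜 2 p = (2 : ℝ≥0∞) ^ ((2 - p.toReal) / p.toReal) ∧
      polConst 𝕜 2 (lp (fun _ : ℕ => 𝕜) p) = (2 : ℝ≥0∞) ^ ((2 - p.toReal) / p.toReal) ∧
      ∃ L : ContinuousMultilinearMap 𝕜 (fun _ : Fin 2 => lp (fun _ : ℕ => 𝕜) p) 𝕜,
        IsSymmForm L ∧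
        (∀ x y : lp (fun _ : ℕ => 𝕜) p, L ![x, y] = (1 / 2 : 𝕜) * (x 0 * y 1 + x 1 * y 0)) ∧
        (∀ x : lp (fun _ : ℕ => 𝕜) p, hatPoly L x = x 0 * x 1) ∧
        ‖L‖ = 1 / 2 ∧
        hatNorm L = (2 : ℝ) ^ (-2 / p.toReal) ∧
        ‖L‖ = (2 : ℝ) ^ ((2 - p.toReal) / p.toReal) * hatNorm L) ∧
    -- real scalars, `2 ≤ p ≤ ∞`
    (∀ (p : ℝ≥0∞) [Fact (1 ≤ p)], 2 ≤ p →
      polConstLp.{u} ℝ 2 p = (2 : ℝ≥0∞) ^ ratioExp p ∧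
      polConst ℝ 2 (lp (fun _ : ℕ => ℝ) p) = (2 : ℝ≥0∞) ^ ratioExp p ∧
      ∃ L : ContinuousMultilinearMap ℝ (fun _ : Fin 2 => lp (fun _ : ℕ => ℝ) p) ℝ,
        IsSymmForm L ∧
        (∀ x y : lp (fun _ : ℕ => ℝ) p, L ![x, y] = x 0 * y 0 - x 1 * y 1) ∧
        (∀ x : lp (fun _ : ℕ => ℝ) p, hatPoly L x = x 0 ^ 2 - x 1 ^ 2) ∧
        hatNorm L = 1 ∧
        ‖L‖ = (2 : ℝ) ^ ratioExp p * hatNorm L) ∧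
    -- the case `p = ∞`
    polConstLp.{u} ℝ 2 ∞ = 2 := by
  have real_case : ∀ (p : ℝ≥0∞) [Fact (1 ≤ p)], 2 ≤ p →
      polConstLp.{u} ℝ 2 p = (2 : ℝ≥0∞) ^ ratioExp p ∧
      polConst ℝ 2 (lp (fun _ : ℕ => ℝ) p) = (2 : ℝ≥0∞) ^ ratioExp p := fun p _ hp2 =>
    polConst_eq_of_extremal (abs_of_nonneg (ratioExp_nonneg hp2)) isSymmForm_differenceForm
      (by simp [hatNorm_differenceForm])
      (by rw [norm_differenceForm hp2, hatNorm_differenceForm, mul_one])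
  refine ⟨fun 𝕜 _ p _ => polConstLp_le 𝕜 p, fun 𝕜 _ p hp1 hp2 => ?_, fun p _ hp2 => ?_, ?_⟩
  · have hp : p ≠ ∞ := ne_top_of_le_ne_top ENNReal.ofNat_ne_top hp2
    have hat := hatNorm_hyperbolicForm (𝕜 := 𝕜) hp
    have hnorm : ‖hyperbolicForm 𝕜 p‖ =
        (2 : ℝ) ^ ((2 - p.toReal) / p.toReal) * hatNorm (hyperbolicForm 𝕜 p) := by
      rw [norm_hyperbolicForm hp2, hat,
        two_rpow_mul_two_rpow_neg_two_div (zero_lt_one.trans_le hp1.out).ne' hp]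
    obtain ⟨h1, h2⟩ := polConst_eq_of_extremal (abs_ratioExp_of_le_two hp2)
      isSymmForm_hyperbolicForm (by rw [hat]; positivity) hnorm
    exact ⟨h1, h2, hyperbolicForm 𝕜 p, isSymmForm_hyperbolicForm,
      fun x y => hyperbolicForm_apply ![x, y], hatPoly_hyperbolicForm, norm_hyperbolicForm hp2,
      hat, hnorm⟩
  · exact ⟨(real_case p hp2).1, (real_case p hp2).2, differenceForm p, isSymmForm_differenceForm,
      fun x y => differenceForm_apply ![x, y], hatPoly_differenceForm, hatNorm_differenceForm,
      by rw [norm_differenceForm hp2, hatNorm_differenceForm, mul_one]⟩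
  · simpa [ratioExp] using (real_case ∞ le_top).1
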